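/- Let $Z$ be a real random variable (the noise) with mean zero and variance $0<\sigma_z^2=\mathbb E[Z^2]<\infty$, and let $\nu$ be its distribution. For $\gamma>0$, a probability distribution $\mu$ on $\mathbb R$ is called a matching source distribution for $\nu$ at signal to noise ratio $\gamma$ if it has mean zero and finite variance, and if, for independent $X\sim\mu$ and $Z\sim\nu$, the following hold: $\mathbb E[X^2]/\sigma_z^2=\gamma$, and the mean square error optimal estimator of $X$ from $Y=X+Z$ is linear, i.e. for some $k\in\mathbb R$ the function $h(y)=ky$ minimizes $\mathbb E[(X-h(Y))^2]$ among all measurable functions $h:\mathbb R\to\mathbb R$. Then a matching source distribution for $\nu$ exists at every $\gamma\in(0,\infty)$ if and only if $\nu$ is infinitely divisible, i.e. for each integer $n\ge 1$ there is a probability distribution on $\mathbb R$ with characteristic function $F_n$ such that the characteristic function $F_Z$ of $Z$ satisfies $F_Z(\omega)=F_n(\omega)^n$ for all $\omega\in\mathbb R$. -/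

import Mathlib

open MeasureTheory
open scoped ENNReal

noncomputable section

namespace LinearEstimation

/-- The mean square error `𝔼[(X - h(Y))²] ∈ [0, ∞]` of the estimator `h` of the source `X` from the
observation `Y = X + Z`, where `X ∼ μ` and `Z ∼ ν` are independent. -/
def mse (μ ν : Measure ℝ) (h : ℝ → ℝ) : ℝ≥0∞ :=
  ∫⁻ p : ℝ × ℝ, ENNReal.ofReal ((p.1 - h (p.1 + p.2)) ^ 2) ∂(μ.prod ν)

/-- `h` is an optimal (mean square error) estimator: it minimizes the mean square error among all
measurable functions of the observation. -/
def IsOptimalEstimator (μ ν : Measure ℝ) (h : ℝ → ℝ) : Prop :=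
  Measurable h ∧ ∀ g : ℝ → ℝ, Measurable g → mse μ ν h ≤ mse μ ν g

/-- The optimal estimator is linear, `h(y) = k y` for some real `k`. -/
def OptimalEstimatorIsLinear (μ ν : Measure ℝ) : Prop :=
  ∃ k : ℝ, IsOptimalEstimator μ ν (fun y => k * y)

/-- A probability distribution on `ℝ` with mean zero and finite variance. -/
structure IsCentered (μ : Measure ℝ) : Prop where
  isProbabilityMeasure : IsProbabilityMeasure μ
  memLp_two : MemLp (fun x : ℝ => x) 2 μ
  mean_eq_zero : ∫ x, x ∂μ = 0

/-- The signal to noise ratio `𝔼[X²] / 𝔼[Z²]`, where `X ∼ μ` and `Z ∼ ν`. -/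
def snr (μ ν : Measure ℝ) : ℝ :=
  (∫ x, x ^ 2 ∂μ) / (∫ z, z ^ 2 ∂ν)

/-- `μ` is a matching source distribution for the noise distribution `ν` at signal to noise
ratio `γ`. -/
structure IsMatchingSource (γ : ℝ) (μ ν : Measure ℝ) : Prop where
  isCentered : IsCentered μ
  snr_eq : snr μ ν = γ
  optimalEstimatorIsLinear : OptimalEstimatorIsLinear μ ν

/-- Infinite divisibility: for each `n ≥ 1` the characteristic function of `ν` is the `n`-th power
of the characteristic function of a probability distribution on `ℝ`. -/
def IsInfinitelyDivisible (ν : Measure ℝ) : Prop :=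
  ∀ n : ℕ, 1 ≤ n → ∃ ρ : Measure ℝ, IsProbabilityMeasure ρ ∧
    ∀ ω : ℝ, charFun ν ω = charFun ρ ω ^ n

end LinearEstimation

end

open Filter Topology Complex

namespace LinearEstimation

/-! ### Characteristic functions on the real line -/

/-! Write `F` for the characteristic function of the noise, `G` for that of the source, and `Y = X +
Z`. The estimator `kY` is optimal iff the error `X - kY` is orthogonal to every square integrable
function of `Y`, and the exponentials `e^{itY}` suffice as tests. By independence this is the
differential equation `(1 - k) G' F = k G F'`. Testing against `Y` itself gives `(1 - k) γ = k`, so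
the equation reads `G' F = γ G F'`, whose solution away from the zeros of `F` is `G = F^γ`.

Matching at `γ = 1/n` thus gives `F = Gⁿ` up to the first zero of `F`. No such zero exists: by the
doubling inequality `1 - |φ(2t)|² ≤ 4 (1 - |φ(t)|²)`, a zero at `2t` forces `|G(t)|² ≤ 3/4` for the
source of each `n`, hence `|F(t)|² ≤ (3/4)ⁿ` for all `n` and `F(t) = 0`
(`ne_zero_two_mul_of_forall_pow`).

Conversely, if the noise is infinitely divisible, `F = exp ψ` vanishes nowhere, and `exp (γψ)` is a
limit of rational powers of `F`, hence a characteristic function by Lévy's theorem. A bound `1 - Re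
G(t) = O(t²)` gives the source a finite variance, and the orthogonality argument runs backwards. -/

/-- The integral `∫ x e^{itx} ∂μ`, i.e. the derivative of the characteristic function up to the
factor `i`. -/
noncomputable def charMoment (μ : Measure ℝ) (t : ℝ) : ℂ :=
  ∫ x, (x : ℂ) * exp (t * x * I) ∂μ

theorem hasDerivAt_charFun {μ : Measure ℝ} [IsFiniteMeasure μ] (hμ : MemLp (fun x : ℝ => x) 2 μ)
    (t : ℝ) : HasDerivAt (charFun μ) (I * charMoment μ t) t := by
  have h1 : MemLp (id : ℝ → ℝ) ((1 : ℕ) : ℝ≥0∞) μ := by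
    have : MemLp (id : ℝ → ℝ) 2 μ := hμ
    exact this.mono_exponent (by norm_num)
  have h := iteratedDeriv_charFun (t := t) h1
  rw [iteratedDeriv_one] at h
  have hd : DifferentiableAt ℝ (charFun μ) t :=
    (contDiff_charFun h1).differentiable (by norm_num) t
  have := hd.hasDerivAt
  rw [h] at this
  simpa [charMoment] using this

theorem continuous_charMoment {μ : Measure ℝ} [IsFiniteMeasure μ]
    (hμ : MemLp (fun x : ℝ => x) 2 μ) : Continuous (charMoment μ) := by
  have hi : Integrable (fun x : ℝ => x) μ := hμ.integrable (by norm_num)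
  refine continuous_of_dominated (bound := fun x => ‖x‖) (fun t => ?_) (fun t => ?_) hi.norm ?_
  · exact (by fun_prop : Measurable fun x : ℝ => (x : ℂ) * exp (t * x * I)).aestronglyMeasurable
  · refine ae_of_all _ fun x => ?_
    rw [norm_mul, ← ofReal_mul, norm_exp_ofReal_mul_I]
    simp
  · exact ae_of_all _ fun x => by fun_prop

/-- Mean zero allows `e^{itx}` to be replaced by `e^{itx} - 1`, which is at most `|tx|` in norm. -/
theorem norm_charMoment_le {μ : Measure ℝ} [IsFiniteMeasure μ]
    (hμ : MemLp (fun x : ℝ => x) 2 μ) (h0 : ∫ x, x ∂μ = 0) (t : ℝ) :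
    ‖charMoment μ t‖ ≤ |t| * ∫ x, x ^ 2 ∂μ := by
  have hi : Integrable (fun x : ℝ => x) μ := hμ.integrable (by norm_num)
  have hi' : Integrable (fun x : ℝ => (x : ℂ)) μ := hi.ofReal
  have h2 : Integrable (fun x : ℝ => x ^ 2) μ := hμ.integrable_sq
  have he : Integrable (fun x : ℝ => (x : ℂ) * exp (t * x * I)) μ := by
    refine hi'.mono (by fun_prop) (ae_of_all _ fun x => ?_)
    rw [norm_mul, ← ofReal_mul, norm_exp_ofReal_mul_I, mul_one]
  have h0' : ∫ x, (x : ℂ) ∂μ = 0 := by rw [integral_complex_ofReal, h0, ofReal_zero]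
  have : charMoment μ t = ∫ x, (x : ℂ) * (exp (t * x * I) - 1) ∂μ := by
    simp_rw [mul_sub, mul_one]
    rw [integral_sub he hi', h0', sub_zero, charMoment]
  rw [this, ← integral_const_mul]
  refine norm_integral_le_of_norm_le (h2.const_mul _) (ae_of_all _ fun x => ?_)
  have := Real.norm_exp_I_mul_ofReal_sub_one_le (x := t * x)
  rw [norm_mul, norm_real, ← ofReal_mul, mul_comm ((t * x : ℝ) : ℂ) I]
  calc ‖x‖ * ‖exp (I * ((t * x : ℝ) : ℂ)) - 1‖ ≤ ‖x‖ * ‖t * x‖ := by gcongr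
    _ = |t| * x ^ 2 := by
      rw [norm_mul, Real.norm_eq_abs, Real.norm_eq_abs, ← sq_abs x]; ring

/-! ### The doubling inequality -/

theorem re_charFun {μ : Measure ℝ} [IsFiniteMeasure μ] (t : ℝ) :
    (charFun μ t).re = ∫ x, Real.cos (t * x) ∂μ := by
  have hi : Integrable (fun x : ℝ => exp (t * x * I)) μ := by
    refine (integrable_const (1 : ℝ)).mono' (by fun_prop) (ae_of_all _ fun x => ?_)
    rw [← ofReal_mul, norm_exp_ofReal_mul_I]
  rw [charFun_apply_real]
  have h := integral_re (𝕜 := ℂ) hi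
  simp only [RCLike.re_eq_complex_re] at h
  rw [← h]
  refine integral_congr_ae (ae_of_all _ fun x => ?_)
  simp only [← ofReal_mul, exp_ofReal_mul_I_re]

theorem integrable_cos {μ : Measure ℝ} [IsFiniteMeasure μ] (t : ℝ) :
    Integrable (fun x => Real.cos (t * x)) μ :=
  (integrable_const (1 : ℝ)).mono' (by fun_prop) (ae_of_all _ fun x => Real.abs_cos_le_one _)

theorem one_sub_re_charFun {μ : Measure ℝ} [IsProbabilityMeasure μ] (t : ℝ) :
    1 - (charFun μ t).re = ∫ x, (1 - Real.cos (t * x)) ∂μ := by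
  rw [integral_sub (integrable_const _) (integrable_cos t), re_charFun]
  simp

/-- Integrate `1 - cos 2θ = 2 (1 - cos² θ) ≤ 4 (1 - cos θ)`. -/
theorem one_sub_re_charFun_two_mul_le {μ : Measure ℝ} [IsProbabilityMeasure μ] (t : ℝ) :
    1 - (charFun μ (2 * t)).re ≤ 4 * (1 - (charFun μ t).re) := by
  rw [one_sub_re_charFun, one_sub_re_charFun, ← integral_const_mul]
  refine integral_mono ((integrable_const _).sub (integrable_cos _))
    (((integrable_const _).sub (integrable_cos _)).const_mul _) fun x => ?_
  simp only
  rw [mul_assoc, Real.cos_two_mul]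
  nlinarith [sq_nonneg (Real.cos (t * x) - 1)]

/-- Symmetrization: `|φ|²` is the characteristic function of the difference of two independent
copies. -/
theorem one_sub_normSq_charFun_two_mul_le {μ : Measure ℝ} [IsProbabilityMeasure μ] (t : ℝ) :
    1 - ‖charFun μ (2 * t)‖ ^ 2 ≤ 4 * (1 - ‖charFun μ t‖ ^ 2) := by
  have hp : IsProbabilityMeasure (μ.map (fun x => (-1 : ℝ) * x)) :=
    Measure.isProbabilityMeasure_map (by fun_prop)
  have key (s : ℝ) : (charFun (μ ∗ μ.map (fun x => (-1 : ℝ) * x)) s).re = ‖charFun μ s‖ ^ 2 := by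
    rw [charFun_conv, charFun_map_mul, neg_one_mul, charFun_neg, mul_conj, ofReal_re,
      normSq_eq_norm_sq]
  rw [← key, ← key]
  exact one_sub_re_charFun_two_mul_le t

/-- If `f` is, in absolute value, a power of arbitrarily high order of characteristic functions,
then its zeros cannot start to occur at the double of a point where it does not vanish. -/
theorem ne_zero_two_mul_of_forall_pow {f : ℝ → ℂ} {t : ℝ} (ht : f t ≠ 0)
    (h : ∀ n : ℕ, 1 ≤ n → ∃ ρ : Measure ℝ, IsProbabilityMeasure ρ ∧
      f t = charFun ρ t ^ n ∧ f (2 * t) = charFun ρ (2 * t) ^ n) : f (2 * t) ≠ 0 := by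
  intro h0
  have hle (n : ℕ) : ‖f t‖ ^ 2 ≤ (3 / 4 : ℝ) ^ (n + 1) := by
    obtain ⟨ρ, hρ, h1, h2⟩ := h (n + 1) (by omega)
    rw [h0] at h2
    have h3 : charFun ρ (2 * t) = 0 := by
      rw [eq_comm] at h2
      exact eq_zero_of_pow_eq_zero h2
    have h4 := one_sub_normSq_charFun_two_mul_le (μ := ρ) t
    rw [h3, norm_zero] at h4
    rw [h1, norm_pow, ← pow_mul, mul_comm, pow_mul]
    exact pow_le_pow_left₀ (by positivity) (by linarith) _
  have hlim : Tendsto (fun n : ℕ => (3 / 4 : ℝ) ^ (n + 1)) atTop (𝓝 0) :=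
    (tendsto_pow_atTop_nhds_zero_of_lt_one (by norm_num) (by norm_num)).comp (tendsto_add_atTop_nat 1)
  have := ge_of_tendsto' hlim hle
  have hpos : 0 < ‖f t‖ ^ 2 := by positivity
  linarith

/-! ### Powers, limits and second moments -/

theorem exists_charFun_eq_pow (μ : Measure ℝ) [IsProbabilityMeasure μ] (m : ℕ) :
    ∃ ρ : Measure ℝ, IsProbabilityMeasure ρ ∧ ∀ t, charFun ρ t = charFun μ t ^ m := by
  induction m with
  | zero => exact ⟨Measure.dirac 0, inferInstance, fun t => by simp⟩
  | succ m ih =>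
    obtain ⟨ρ, hρ, h⟩ := ih
    exact ⟨ρ ∗ μ, inferInstance, fun t => by rw [charFun_conv, h, pow_succ]⟩

/-- **Lévy's continuity theorem**, existence of the limit: a pointwise limit of characteristic
functions which is continuous at `0` is a characteristic function. -/
theorem exists_charFun_eq_of_tendsto {μ : ℕ → Measure ℝ} [∀ n, IsProbabilityMeasure (μ n)]
    {f : ℝ → ℂ} (hf : ContinuousAt f 0)
    (h : ∀ t, Tendsto (fun n => charFun (μ n) t) atTop (𝓝 (f t))) :
    ∃ ρ : Measure ℝ, IsProbabilityMeasure ρ ∧ ∀ t, charFun ρ t = f t := by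
  let P : ℕ → ProbabilityMeasure ℝ := fun n => ⟨μ n, inferInstance⟩
  have ht : IsTightMeasureSet (Set.range μ) := isTightMeasureSet_of_tendsto_charFun hf h
  have hc : IsCompact (closure (Set.range P)) := by
    refine isCompact_closure_of_isTightMeasureSet (ht.subset ?_)
    rintro _ ⟨_, ⟨n, rfl⟩, rfl⟩
    exact ⟨n, rfl⟩
  -- By tightness the laws converge weakly along any ultrafilter, so no subsequence is needed; the
  -- assumed pointwise limit then identifies the characteristic function.
  let U : Ultrafilter ℕ := hyperfilter ℕ
  have hU : (U : Filter ℕ) ≤ atTop := Nat.hyperfilter_le_atTop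
  obtain ⟨ρ, -, hρ⟩ := hc.ultrafilter_le_nhds (U.map P)
    (le_principal_iff.2 (mem_map.2 (univ_mem' fun n => subset_closure ⟨n, rfl⟩)))
  refine ⟨ρ, inferInstance, fun t => tendsto_nhds_unique ?_ ((h t).mono_left hU)⟩
  have hρ' : Tendsto P U (𝓝 ρ) := hρ
  rw [ProbabilityMeasure.tendsto_iff_forall_integral_rclike_tendsto ℂ] at hρ'
  simp_rw [charFun_eq_integral_innerProbChar]
  exact hρ' (BoundedContinuousFunction.innerProbChar t)

/-- If the characteristic function of a probability measure satisfies `1 - Re φ(t) = O(t²)` at `0`,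
then the measure has finite variance. -/
theorem memLp_two_of_one_sub_re_charFun_le {μ : Measure ℝ} [IsProbabilityMeasure μ] {C δ : ℝ}
    (hδ : 0 < δ) (h : ∀ t, 0 < t → t < δ → 1 - (charFun μ t).re ≤ C * t ^ 2) :
    MemLp (fun x : ℝ => x) 2 μ := by
  -- The quotient equals `x² sinc²(tx/2)`. Fatou's lemma along `t = 1/(n+1)` then bounds the second
  -- moment by `2C`.
  have hlim (x : ℝ) : Tendsto (fun t : ℝ => 2 * (1 - Real.cos (t * x)) / t ^ 2) (𝓝[>] 0)
      (𝓝 (x ^ 2)) := by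
    have h1 : Tendsto (fun t : ℝ => x ^ 2 * Real.sinc (t * x / 2) ^ 2) (𝓝[>] 0)
        (𝓝 (x ^ 2)) := by
      have : Continuous fun t : ℝ => x ^ 2 * Real.sinc (t * x / 2) ^ 2 := by
        have := Real.continuous_sinc
        fun_prop
      have h2 := this.tendsto 0
      simp only [zero_mul, zero_div, Real.sinc_zero, one_pow, mul_one] at h2
      exact h2.mono_left nhdsWithin_le_nhds
    refine h1.congr' ?_
    filter_upwards [self_mem_nhdsWithin] with t ht
    have ht0 : t ≠ 0 := ne_of_gt ht
    rcases eq_or_ne x 0 with rfl | hx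
    · simp
    rw [Real.sinc_of_ne_zero (by positivity)]
    have h3 : Real.cos (t * x) = 1 - 2 * Real.sin (t * x / 2) ^ 2 := by
      have h4 := Real.cos_two_mul (t * x / 2)
      have h5 := Real.sin_sq_add_cos_sq (t * x / 2)
      rw [mul_div_cancel₀ _ (two_ne_zero)] at h4
      linarith
    rw [h3]
    field_simp
    ring
  let u : ℕ → ℝ := fun n => 1 / ((n : ℝ) + 1)
  have hu0 (n : ℕ) : 0 < u n := by positivity
  have hu : Tendsto u atTop (𝓝[>] 0) :=
    tendsto_nhdsWithin_iff.2 ⟨tendsto_one_div_add_atTop_nhds_zero_nat, .of_forall hu0⟩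
  have hb : ∀ᶠ n in atTop, ∫⁻ x, ENNReal.ofReal (2 * (1 - Real.cos (u n * x)) / u n ^ 2) ∂μ
      ≤ ENNReal.ofReal (2 * C) := by
    have hδ' : ∀ᶠ t in 𝓝[>] (0 : ℝ), t < δ := (eventually_lt_nhds hδ).filter_mono nhdsWithin_le_nhds
    filter_upwards [hu.eventually hδ'] with n hn
    have hint : Integrable (fun x => 2 * (1 - Real.cos (u n * x)) / u n ^ 2) μ :=
      ((((integrable_const _).sub (integrable_cos _)).const_mul _).div_const _)
    rw [← ofReal_integral_eq_lintegral_ofReal hint (ae_of_all _ fun x => ?_)]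
    · refine ENNReal.ofReal_le_ofReal ?_
      rw [integral_div, integral_const_mul, ← one_sub_re_charFun]
      have := h (u n) (hu0 n) hn
      have := hu0 n
      rw [div_le_iff₀ (by positivity)]
      linarith
    · have := Real.cos_le_one (u n * x)
      have := hu0 n
      simp only [Pi.zero_apply]
      refine div_nonneg ?_ (by positivity)
      linarith
  have hfatou : ∫⁻ x, ENNReal.ofReal (x ^ 2) ∂μ ≤ ENNReal.ofReal (2 * C) := by
    calc ∫⁻ x, ENNReal.ofReal (x ^ 2) ∂μ
        = ∫⁻ x, liminf (fun n => ENNReal.ofReal (2 * (1 - Real.cos (u n * x)) / u n ^ 2)) atTop ∂μ := by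
          refine lintegral_congr fun x => ?_
          exact (((ENNReal.continuous_ofReal.tendsto _).comp
            ((hlim x).comp hu)).liminf_eq).symm
      _ ≤ liminf (fun n => ∫⁻ x, ENNReal.ofReal (2 * (1 - Real.cos (u n * x)) / u n ^ 2) ∂μ) atTop :=
          lintegral_liminf_le fun n => by fun_prop
      _ ≤ ENNReal.ofReal (2 * C) := by
          refine (liminf_le_liminf hb).trans ?_
          simp
  rw [memLp_two_iff_integrable_sq (by fun_prop)]
  refine ⟨by fun_prop, ?_⟩
  rw [hasFiniteIntegral_iff_ofReal (ae_of_all _ fun x => sq_nonneg x)]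
  exact hfatou.trans_lt ENNReal.ofReal_lt_top

/-! ### Orthogonality and optimal estimators -/

section Orthogonality

variable {Ω : Type*} [MeasurableSpace Ω] {P : Measure Ω}

/-- The law of `Y` under the (unnormalized) density `W⁺`. -/
noncomputable def weightedLaw (P : Measure Ω) (W Y : Ω → ℝ) : Measure ℝ :=
  (P.withDensity fun ω => ENNReal.ofReal (W ω)).map Y

theorem isFiniteMeasure_weightedLaw {W : Ω → ℝ} (Y : Ω → ℝ) (hW : Integrable W P) :
    IsFiniteMeasure (weightedLaw P W Y) := by
  have := isFiniteMeasure_withDensity_ofReal hW.2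
  exact Measure.isFiniteMeasure_map _ _

theorem integral_weightedLaw {E : Type*} [NormedAddCommGroup E] [NormedSpace ℝ E]
    {W Y : Ω → ℝ} (hW : Measurable W) (hY : Measurable Y) {φ : ℝ → E} (hφ : StronglyMeasurable φ) :
    ∫ y, φ y ∂(weightedLaw P W Y) = ∫ ω, max (W ω) 0 • φ (Y ω) ∂P := by
  rw [weightedLaw, integral_map hY.aemeasurable hφ.aestronglyMeasurable,
    integral_withDensity_eq_integral_toReal_smul hW.ennreal_ofReal
      (ae_of_all _ fun ω => ENNReal.ofReal_lt_top)]
  simp [ENNReal.toReal_ofReal']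

theorem integral_smul_comp_eq_sub {E : Type*} [NormedAddCommGroup E] [NormedSpace ℝ E]
    {W Y : Ω → ℝ} (hW : Measurable W) (hY : Measurable Y) {φ : ℝ → E} (hφ : StronglyMeasurable φ)
    (hi : Integrable (fun ω => W ω • φ (Y ω)) P) :
    ∫ ω, W ω • φ (Y ω) ∂P = ∫ y, φ y ∂(weightedLaw P W Y) -
      ∫ y, φ y ∂(weightedLaw P (fun ω => -W ω) Y) := by
  have hφY : StronglyMeasurable fun ω => φ (Y ω) := hφ.comp_measurable hY
  have hpos (V : Ω → ℝ) (hV : Measurable V) (hle : ∀ ω, |max (V ω) 0| ≤ |W ω|) :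
      Integrable (fun ω => max (V ω) 0 • φ (Y ω)) P := by
    refine hi.mono ((hV.max measurable_const).stronglyMeasurable.smul hφY).aestronglyMeasurable
      (ae_of_all _ fun ω => ?_)
    rw [norm_smul, norm_smul]
    exact mul_le_mul_of_nonneg_right (hle ω) (norm_nonneg _)
  rw [integral_weightedLaw hW hY hφ, integral_weightedLaw (W := fun ω => -W ω) hW.neg hY hφ,
    ← integral_sub (hpos _ hW fun ω => ?_) (hpos (fun ω => -W ω) hW.neg fun ω => ?_)]
  · refine integral_congr_ae (ae_of_all _ fun ω => ?_)
    simp only [← sub_smul]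
    congr 1
    exact (max_zero_sub_max_neg_zero_eq_self _).symm
  · rw [abs_of_nonneg (le_max_right _ _)]
    exact max_le (le_abs_self _) (abs_nonneg _)
  · rw [abs_of_nonneg (le_max_right _ _)]
    exact max_le (neg_le_abs _) (abs_nonneg _)

/-- A random variable whose correlation with `e^{itY}` vanishes for each `t` is orthogonal to all
functions of `Y`. -/
theorem integral_mul_comp_eq_zero_of_charFun {W Y : Ω → ℝ} (hW : Measurable W) (hY : Measurable Y)
    (hWi : Integrable W P) (h : ∀ t : ℝ, ∫ ω, (W ω : ℂ) * exp (t * Y ω * I) ∂P = 0)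
    {g : ℝ → ℝ} (hg : Measurable g) (hi : Integrable (fun ω => W ω * g (Y ω)) P) :
    ∫ ω, W ω * g (Y ω) ∂P = 0 := by
  have := isFiniteMeasure_weightedLaw Y hWi
  have := isFiniteMeasure_weightedLaw Y hWi.neg
  -- The hypothesis says that the laws of `Y` weighted by `W⁺` and by `W⁻` have the same
  -- characteristic function.
  have heq : weightedLaw P W Y = weightedLaw P (fun ω => -W ω) Y := by
    refine Measure.ext_of_charFun (funext fun t => ?_)
    have hie : Integrable (fun ω => W ω • exp (t * Y ω * I)) P := by
      refine hWi.mono (by fun_prop) (ae_of_all _ fun ω => ?_)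
      rw [norm_smul, ← ofReal_mul, norm_exp_ofReal_mul_I, mul_one]
    have h1 := integral_smul_comp_eq_sub (φ := fun y : ℝ => exp (t * y * I)) hW hY
      (by fun_prop : Measurable fun y : ℝ => exp (t * y * I)).stronglyMeasurable hie
    simp_rw [real_smul] at h1
    rw [h t] at h1
    rw [charFun_apply_real, charFun_apply_real]
    exact (sub_eq_zero.1 h1.symm)
  have h2 := integral_smul_comp_eq_sub hW hY hg.stronglyMeasurable hi
  simp_rw [smul_eq_mul] at h2
  rw [h2, heq, sub_self]

/-- First order condition for the minimization of a quadratic function. -/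
theorem integral_mul_eq_zero_of_forall_le {W V : Ω → ℝ} (hW : MemLp W 2 P) (hV : MemLp V 2 P)
    (h : ∀ s : ℝ, ∫ ω, W ω ^ 2 ∂P ≤ ∫ ω, (W ω - s * V ω) ^ 2 ∂P) : ∫ ω, W ω * V ω ∂P = 0 := by
  have hWV : Integrable (fun ω => W ω * V ω) P := hW.integrable_mul hV
  have hexp (s : ℝ) : ∫ ω, (W ω - s * V ω) ^ 2 ∂P =
      ∫ ω, W ω ^ 2 ∂P - 2 * s * ∫ ω, W ω * V ω ∂P + s ^ 2 * ∫ ω, V ω ^ 2 ∂P := by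
    have h1 : Integrable (fun ω => W ω ^ 2 - 2 * s * (W ω * V ω)) P :=
      hW.integrable_sq.sub (hWV.const_mul _)
    rw [← integral_const_mul, ← integral_const_mul,
      ← integral_sub hW.integrable_sq (hWV.const_mul _),
      ← integral_add h1 (hV.integrable_sq.const_mul _)]
    exact integral_congr_ae (ae_of_all _ fun ω => by ring)
  have hc : 0 ≤ ∫ ω, V ω ^ 2 ∂P := integral_nonneg fun ω => sq_nonneg _
  simp_rw [hexp] at h
  set b := ∫ ω, W ω * V ω ∂P
  set c := ∫ ω, V ω ^ 2 ∂P
  -- The minimizer is `b / c`; adding `1` to the denominator covers `c = 0` and still yields a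
  -- strict decrease unless `b = 0`.
  have h1 := h (b / (c + 1))
  have h2 : 2 * (b / (c + 1)) * b - (b / (c + 1)) ^ 2 * c = b ^ 2 * (c + 2) / (c + 1) ^ 2 := by
    field_simp
    ring
  have h3 : b ^ 2 * (c + 2) / (c + 1) ^ 2 ≤ 0 := by linarith
  rw [div_le_iff₀ (by positivity), zero_mul] at h3
  have h4 : b ^ 2 ≤ 0 := by nlinarith [sq_nonneg b, mul_nonneg (sq_nonneg b) hc]
  exact pow_eq_zero_iff (two_ne_zero) |>.1 (le_antisymm h4 (sq_nonneg b))

end Orthogonality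

/-! ### Source and noise on the product space -/

section Prod

theorem integrable_mul_exp_prod {μ ν : Measure ℝ} {f : ℝ × ℝ → ℝ} (hf : Integrable f (μ.prod ν)) (t : ℝ) :
    Integrable (fun p : ℝ × ℝ => (f p : ℂ) * exp (t * (p.1 + p.2 : ℝ) * I)) (μ.prod ν) := by
  refine hf.mono (hf.ofReal.1.mul (by fun_prop)) (ae_of_all _ fun p => ?_)
  rw [norm_mul, ← ofReal_mul, norm_exp_ofReal_mul_I, mul_one, norm_real]

theorem mse_eq_ofReal_integral {μ ν : Measure ℝ} {h : ℝ → ℝ}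
    (hh : MemLp (fun p : ℝ × ℝ => p.1 - h (p.1 + p.2)) 2 (μ.prod ν)) :
    mse μ ν h = ENNReal.ofReal (∫ p : ℝ × ℝ, (p.1 - h (p.1 + p.2)) ^ 2 ∂(μ.prod ν)) := by
  rw [mse, ofReal_integral_eq_lintegral_ofReal hh.integrable_sq (ae_of_all _ fun p => sq_nonneg _)]

theorem memLp_source {μ ν : Measure ℝ} [IsProbabilityMeasure ν]
    (hμ : MemLp (fun x : ℝ => x) 2 μ) :
    MemLp (fun p : ℝ × ℝ => p.1) 2 (μ.prod ν) :=
  hμ.comp_measurePreserving measurePreserving_fst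

variable {μ ν : Measure ℝ} [IsProbabilityMeasure μ] [IsProbabilityMeasure ν]

theorem memLp_noise (hν : MemLp (fun x : ℝ => x) 2 ν) :
    MemLp (fun p : ℝ × ℝ => p.2) 2 (μ.prod ν) :=
  hν.comp_measurePreserving measurePreserving_snd

theorem memLp_observation (hμ : MemLp (fun x : ℝ => x) 2 μ) (hν : MemLp (fun x : ℝ => x) 2 ν) :
    MemLp (fun p : ℝ × ℝ => p.1 + p.2) 2 (μ.prod ν) :=
  (memLp_source hμ).add (memLp_noise hν)

theorem memLp_linear_error (hμ : MemLp (fun x : ℝ => x) 2 μ) (hν : MemLp (fun x : ℝ => x) 2 ν)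
    (k : ℝ) : MemLp (fun p : ℝ × ℝ => p.1 - k * (p.1 + p.2)) 2 (μ.prod ν) :=
  (memLp_source hμ).sub ((memLp_observation hμ hν).const_mul k)

/-- The error of an optimal linear estimator is orthogonal to all functions of the observation. -/
theorem IsOptimalEstimator.integral_mul_eq_zero (hμ : MemLp (fun x : ℝ => x) 2 μ)
    (hν : MemLp (fun x : ℝ => x) 2 ν) {k : ℝ} (h : IsOptimalEstimator μ ν fun y => k * y)
    {g : ℝ → ℝ} (hg : Measurable g) (hg2 : MemLp (fun p : ℝ × ℝ => g (p.1 + p.2)) 2 (μ.prod ν)) :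
    ∫ p : ℝ × ℝ, (p.1 - k * (p.1 + p.2)) * g (p.1 + p.2) ∂(μ.prod ν) = 0 := by
  refine integral_mul_eq_zero_of_forall_le (memLp_linear_error hμ hν k) hg2 fun s => ?_
  have hs : MemLp (fun p : ℝ × ℝ => p.1 - (k * (p.1 + p.2) + s * g (p.1 + p.2))) 2 (μ.prod ν) := by
    convert! (memLp_linear_error hμ hν k).sub (hg2.const_mul s) using 1
    ext p
    simp only [Pi.sub_apply]
    ring
  have h1 := h.2 (fun y => k * y + s * g y) (by fun_prop)
  rw [mse_eq_ofReal_integral (memLp_linear_error hμ hν k), mse_eq_ofReal_integral hs,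
    ENNReal.ofReal_le_ofReal_iff (integral_nonneg fun p => sq_nonneg _)] at h1
  simpa only [sub_sub] using h1

/-- The error is `(1 - k) X - k Z`, and independence factors each of the two expectations. -/
theorem integral_linear_error_mul_exp (hμ : MemLp (fun x : ℝ => x) 2 μ)
    (hν : MemLp (fun x : ℝ => x) 2 ν) (k t : ℝ) :
    ∫ p : ℝ × ℝ, ((p.1 - k * (p.1 + p.2) : ℝ) : ℂ) * exp (t * (p.1 + p.2 : ℝ) * I) ∂(μ.prod ν) =
      (1 - k) * charMoment μ t * charFun ν t - k * charFun μ t * charMoment ν t := by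
  have h1 := integrable_mul_exp_prod ((memLp_source (ν := ν) hμ).integrable (by norm_num)) t
  have h2 := integrable_mul_exp_prod ((memLp_noise (μ := μ) hν).integrable (by norm_num)) t
  have e1 : ∫ p : ℝ × ℝ, (p.1 : ℂ) * exp (t * (p.1 + p.2 : ℝ) * I) ∂(μ.prod ν) =
      charMoment μ t * charFun ν t := by
    rw [charMoment, charFun_apply_real, ← integral_prod_mul]
    refine integral_congr_ae (ae_of_all _ fun p => ?_)
    simp only
    rw [mul_assoc (p.1 : ℂ), ← exp_add]
    push_cast
    ring_nf
  have e2 : ∫ p : ℝ × ℝ, (p.2 : ℂ) * exp (t * (p.1 + p.2 : ℝ) * I) ∂(μ.prod ν) =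
      charFun μ t * charMoment ν t := by
    rw [charMoment, charFun_apply_real, ← integral_prod_mul]
    refine integral_congr_ae (ae_of_all _ fun p => ?_)
    simp only
    rw [mul_left_comm, ← exp_add]
    push_cast
    ring_nf
  rw [mul_assoc, mul_assoc, ← e1, ← e2, ← integral_const_mul, ← integral_const_mul,
    ← integral_sub (h1.const_mul _) (h2.const_mul _)]
  refine integral_congr_ae (ae_of_all _ fun p => ?_)
  simp only
  push_cast
  ring

theorem integral_linear_error (hμ : MemLp (fun x : ℝ => x) 2 μ)
    (hν : MemLp (fun x : ℝ => x) 2 ν) (hν0 : ∫ z, z ∂ν = 0) (k : ℝ) :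
    ∫ p : ℝ × ℝ, (p.1 - k * (p.1 + p.2)) ∂(μ.prod ν) = (1 - k) * ∫ x, x ∂μ := by
  have h1 := (memLp_source (ν := ν) hμ).integrable one_le_two
  have h2 := (memLp_noise (μ := μ) hν).integrable one_le_two
  have h12 : Integrable (fun p : ℝ × ℝ => p.1 + p.2) (μ.prod ν) := h1.add h2
  have e1 : ∫ p : ℝ × ℝ, p.1 ∂(μ.prod ν) = ∫ x, x ∂μ := by
    simpa using integral_fun_fst (μ := μ) (ν := ν) fun x : ℝ => x
  have e2 : ∫ p : ℝ × ℝ, p.2 ∂(μ.prod ν) = 0 := by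
    simpa [hν0] using integral_fun_snd (μ := μ) (ν := ν) fun x : ℝ => x
  rw [integral_sub h1 (h12.const_mul k), integral_const_mul, integral_add h1 h2, e1, e2]
  ring

theorem integral_linear_error_mul_observation (hμ : MemLp (fun x : ℝ => x) 2 μ)
    (hν : MemLp (fun x : ℝ => x) 2 ν) (hν0 : ∫ z, z ∂ν = 0) (k : ℝ) :
    ∫ p : ℝ × ℝ, (p.1 - k * (p.1 + p.2)) * (p.1 + p.2) ∂(μ.prod ν) =
      (1 - k) * ∫ x, x ^ 2 ∂μ - k * ∫ z, z ^ 2 ∂ν := by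
  have h1 := memLp_source (ν := ν) hμ
  have h2 := memLp_noise (μ := μ) hν
  have h12 : Integrable (fun p : ℝ × ℝ => p.1 * p.2) (μ.prod ν) := h1.integrable_mul h2
  have e1 : ∫ p : ℝ × ℝ, p.1 ^ 2 ∂(μ.prod ν) = ∫ x, x ^ 2 ∂μ := by
    simpa using integral_fun_fst (μ := μ) (ν := ν) fun x : ℝ => x ^ 2
  have e2 : ∫ p : ℝ × ℝ, p.2 ^ 2 ∂(μ.prod ν) = ∫ z, z ^ 2 ∂ν := by
    simpa using integral_fun_snd (μ := μ) (ν := ν) fun x : ℝ => x ^ 2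
  have e3 : ∫ p : ℝ × ℝ, p.1 * p.2 ∂(μ.prod ν) = 0 := by
    rw [integral_prod_mul (fun x : ℝ => x) (fun x : ℝ => x), hν0, mul_zero]
  have e : ∀ p : ℝ × ℝ, (p.1 - k * (p.1 + p.2)) * (p.1 + p.2) =
      (1 - k) * p.1 ^ 2 + (1 - 2 * k) * (p.1 * p.2) - k * p.2 ^ 2 := fun p => by ring
  have hs : Integrable (fun p : ℝ × ℝ => (1 - k) * p.1 ^ 2 + (1 - 2 * k) * (p.1 * p.2))
      (μ.prod ν) := (h1.integrable_sq.const_mul _).add (h12.const_mul _)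
  simp_rw [e]
  rw [integral_sub hs (h2.integrable_sq.const_mul _), integral_add (h1.integrable_sq.const_mul _) (h12.const_mul _),
    integral_const_mul, integral_const_mul, integral_const_mul, e1, e2, e3]
  ring

/-- The differential equation satisfied by the characteristic functions of a source and a noise for
which the optimal estimator is linear. -/
theorem IsOptimalEstimator.charMoment_mul_charFun (hμ : MemLp (fun x : ℝ => x) 2 μ)
    (hν : MemLp (fun x : ℝ => x) 2 ν) {k : ℝ} (h : IsOptimalEstimator μ ν fun y => k * y) (t : ℝ) :
    (1 - k) * charMoment μ t * charFun ν t = k * charFun μ t * charMoment ν t := by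
  rw [← sub_eq_zero, ← integral_linear_error_mul_exp hμ hν]
  -- Orthogonality concerns real functions, so the exponential is tested through its cosine and sine
  -- parts.
  have hb (g : ℝ → ℝ) (hg : Measurable g) (hg1 : ∀ y, |g y| ≤ 1) :
      ∫ p : ℝ × ℝ, (p.1 - k * (p.1 + p.2)) * g (p.1 + p.2) ∂(μ.prod ν) = 0 :=
    h.integral_mul_eq_zero hμ hν hg
      (MemLp.of_bound (by fun_prop : Measurable fun p : ℝ × ℝ => g (p.1 + p.2)).aestronglyMeasurable 1 (ae_of_all _ fun p => hg1 _))
  have hi := integrable_mul_exp_prod ((memLp_linear_error hμ hν k).integrable (by norm_num)) t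
  have hre := hb (fun y => Real.cos (t * y)) (by fun_prop) fun y => Real.abs_cos_le_one _
  have him := hb (fun y => Real.sin (t * y)) (by fun_prop) fun y => Real.abs_sin_le_one _
  have h1 := integral_re (𝕜 := ℂ) hi
  have h2 := integral_im (𝕜 := ℂ) hi
  simp only [RCLike.re_eq_complex_re, RCLike.im_eq_complex_im, re_ofReal_mul, im_ofReal_mul,
    ← ofReal_mul t, exp_ofReal_mul_I_re, exp_ofReal_mul_I_im] at h1 h2
  apply Complex.ext
  · simp only [← ofReal_mul t]
    rw [← h1, hre, zero_re]
  · simp only [← ofReal_mul t]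
    rw [← h2, him, zero_im]

/-- A linear estimator whose error is orthogonal to all functions of the observation is
optimal. -/
theorem isOptimalEstimator_of_integral_mul_eq_zero (hμ : MemLp (fun x : ℝ => x) 2 μ)
    (hν : MemLp (fun x : ℝ => x) 2 ν) {k : ℝ}
    (h : ∀ {g : ℝ → ℝ}, Measurable g → MemLp (fun p : ℝ × ℝ => g (p.1 + p.2)) 2 (μ.prod ν) →
      ∫ p : ℝ × ℝ, (p.1 - k * (p.1 + p.2)) * g (p.1 + p.2) ∂(μ.prod ν) = 0) :
    IsOptimalEstimator μ ν fun y => k * y := by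
  refine ⟨by fun_prop, fun g hg => ?_⟩
  rcases eq_or_ne (mse μ ν g) ∞ with htop | htop
  · rw [htop]
    exact le_top
  have hgm : Measurable fun p : ℝ × ℝ => p.1 - g (p.1 + p.2) := by fun_prop
  have hgL : MemLp (fun p : ℝ × ℝ => p.1 - g (p.1 + p.2)) 2 (μ.prod ν) := by
    rw [memLp_two_iff_integrable_sq hgm.aestronglyMeasurable]
    refine ⟨by fun_prop, ?_⟩
    rw [hasFiniteIntegral_iff_ofReal (ae_of_all _ fun p => sq_nonneg _)]
    exact lt_top_iff_ne_top.2 htop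
  have hkL := memLp_linear_error hμ hν k
  have hdL : MemLp (fun p : ℝ × ℝ => k * (p.1 + p.2) - g (p.1 + p.2)) 2 (μ.prod ν) := by
    convert! hgL.sub hkL using 1
    ext p
    simp
  have h0 := h (g := fun y => k * y - g y) (by fun_prop) hdL
  have hmul : Integrable (fun p : ℝ × ℝ => (p.1 - k * (p.1 + p.2)) *
      (k * (p.1 + p.2) - g (p.1 + p.2))) (μ.prod ν) := hkL.integrable_mul hdL
  rw [mse_eq_ofReal_integral hkL, mse_eq_ofReal_integral hgL]
  refine ENNReal.ofReal_le_ofReal ?_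
  have e (p : ℝ × ℝ) : (p.1 - g (p.1 + p.2)) ^ 2 = (p.1 - k * (p.1 + p.2)) ^ 2 +
      2 * ((p.1 - k * (p.1 + p.2)) * (k * (p.1 + p.2) - g (p.1 + p.2))) +
      (k * (p.1 + p.2) - g (p.1 + p.2)) ^ 2 := by ring
  have hs : Integrable (fun p : ℝ × ℝ => (p.1 - k * (p.1 + p.2)) ^ 2 +
      2 * ((p.1 - k * (p.1 + p.2)) * (k * (p.1 + p.2) - g (p.1 + p.2)))) (μ.prod ν) :=
    hkL.integrable_sq.add (hmul.const_mul 2)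
  simp_rw [e]
  rw [integral_add hs hdL.integrable_sq,
    integral_add hkL.integrable_sq (hmul.const_mul 2), integral_const_mul, h0]
  have : 0 ≤ ∫ p : ℝ × ℝ, (k * (p.1 + p.2) - g (p.1 + p.2)) ^ 2 ∂(μ.prod ν) :=
    integral_nonneg fun p => sq_nonneg _
  linarith

/-- Converse of `IsOptimalEstimator.charMoment_mul_charFun`: the equation makes the error
uncorrelated with every `e^{itY}`. -/
theorem integral_linear_error_mul_eq_zero (hμ : MemLp (fun x : ℝ => x) 2 μ)
    (hν : MemLp (fun x : ℝ => x) 2 ν) {k : ℝ}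
    (h : ∀ t, (1 - k) * charMoment μ t * charFun ν t = k * charFun μ t * charMoment ν t)
    {g : ℝ → ℝ} (hg : Measurable g) (hg2 : MemLp (fun p : ℝ × ℝ => g (p.1 + p.2)) 2 (μ.prod ν)) :
    ∫ p : ℝ × ℝ, (p.1 - k * (p.1 + p.2)) * g (p.1 + p.2) ∂(μ.prod ν) = 0 := by
  have hkL := memLp_linear_error hμ hν k
  refine integral_mul_comp_eq_zero_of_charFun (P := μ.prod ν)
    (W := fun p => p.1 - k * (p.1 + p.2)) (Y := fun p => p.1 + p.2) (by fun_prop) (by fun_prop)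
    (hkL.integrable (by norm_num)) (fun t => ?_) hg (hkL.integrable_mul hg2)
  rw [integral_linear_error_mul_exp hμ hν, h t, sub_self]

end Prod

/-! ### Matching sources and infinite divisibility -/

theorem IsMatchingSource.charMoment_mul_charFun {γ : ℝ} {μ ν : Measure ℝ}
    (h : IsMatchingSource γ μ ν) (hν : IsCentered ν) (hvar : 0 < ∫ z, z ^ 2 ∂ν) (t : ℝ) :
    charMoment μ t * charFun ν t = γ * charFun μ t * charMoment ν t := by
  have := h.isCentered.isProbabilityMeasure
  have := hν.isProbabilityMeasure
  have hμ2 := h.isCentered.memLp_two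
  have hν2 := hν.memLp_two
  obtain ⟨k, hk⟩ := h.optimalEstimatorIsLinear
  -- Testing the error against `Y` determines `k` through `(1 - k) γ = k`, which also rules out `k =
  -- 1`.
  have h1 := hk.integral_mul_eq_zero hμ2 hν2 measurable_id (memLp_observation hμ2 hν2)
  simp only [id_eq] at h1
  rw [integral_linear_error_mul_observation hμ2 hν2 hν.mean_eq_zero] at h1
  have hs : ∫ x, x ^ 2 ∂μ = γ * ∫ z, z ^ 2 ∂ν := by
    have := h.snr_eq
    rwa [snr, div_eq_iff hvar.ne'] at this
  rw [hs] at h1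
  have h2 : (1 - k) * γ = k := by
    have : ((1 - k) * γ - k) * ∫ z, z ^ 2 ∂ν = 0 := by linarith
    rcases mul_eq_zero.1 this with h | h
    · linarith
    · exact absurd h hvar.ne'
  have h3 : 1 - k ≠ 0 := by
    intro h0
    rw [h0, zero_mul] at h2
    rw [← h2] at h0
    norm_num at h0
  have h4 := hk.charMoment_mul_charFun hμ2 hν2 t
  have h2' : (1 - (k : ℂ)) * γ = k := by exact_mod_cast congrArg ofReal h2
  have h3' : (1 - (k : ℂ)) ≠ 0 := by exact_mod_cast h3
  refine mul_left_cancel₀ h3' ?_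
  calc (1 - (k : ℂ)) * (charMoment μ t * charFun ν t)
      = (1 - k) * charMoment μ t * charFun ν t := by ring
    _ = k * charFun μ t * charMoment ν t := h4
    _ = (1 - k) * γ * charFun μ t * charMoment ν t := by rw [h2']
    _ = _ := by ring

theorem charFun_zero_eq_one (μ : Measure ℝ) [IsProbabilityMeasure μ] : charFun μ 0 = 1 := by
  simp

/-- The differential equation `n G' F = G F'` integrates to `F = Gⁿ` up to the first zero of `F`. -/
theorem charFun_eq_pow_of_forall_ne_zero {μ ν : Measure ℝ} [IsProbabilityMeasure μ]
    [IsProbabilityMeasure ν] (hμ : MemLp (fun x : ℝ => x) 2 μ) (hν : MemLp (fun x : ℝ => x) 2 ν)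
    {n : ℕ} (hn : 1 ≤ n) (h : ∀ t, n * charMoment μ t * charFun ν t = charFun μ t * charMoment ν t) {t : ℝ}
    (ht : 0 ≤ t) (h0 : ∀ s ∈ Set.Icc 0 t, charFun ν s ≠ 0) :
    charFun ν t = charFun μ t ^ n := by
  have hd : ∀ s ∈ Set.Icc 0 t, HasDerivAt (fun s => charFun μ s ^ n / charFun ν s) 0 s := by
    intro s hs
    have h1 := ((hasDerivAt_charFun hμ s).pow n).div (hasDerivAt_charFun hν s) (h0 s hs)
    convert! h1 using 1
    rw [eq_comm, div_eq_zero_iff]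
    left
    have h2 := h s
    obtain ⟨m, rfl⟩ := Nat.exists_eq_succ_of_ne_zero (by omega : n ≠ 0)
    simp only [Nat.succ_eq_add_one, Nat.add_sub_cancel, Pi.pow_apply, pow_succ]
    linear_combination I * charFun μ s ^ m * h2
  have hc := constant_of_has_deriv_right_zero (f := fun s => charFun μ s ^ n / charFun ν s)
    (a := 0) (b := t) (fun s hs => (hd s hs).continuousAt.continuousWithinAt)
    (fun s hs => (hd s ⟨hs.1, hs.2.le⟩).hasDerivWithinAt) t ⟨ht, le_rfl⟩
  simp only [charFun_zero_eq_one, one_pow, div_one] at hc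
  rw [div_eq_one_iff_eq (h0 t ⟨ht, le_rfl⟩)] at hc
  exact hc.symm

theorem isInfinitelyDivisible_of_forall_exists {ν : Measure ℝ} [IsProbabilityMeasure ν]
    (hν : MemLp (fun x : ℝ => x) 2 ν)
    (h : ∀ n : ℕ, 1 ≤ n → ∃ μ : Measure ℝ, IsProbabilityMeasure μ ∧ MemLp (fun x : ℝ => x) 2 μ ∧
      ∀ t, n * charMoment μ t * charFun ν t = charFun μ t * charMoment ν t) :
    IsInfinitelyDivisible ν := by
  have hpos (t : ℝ) (ht : 0 ≤ t) : charFun ν t ≠ 0 := by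
    intro h0
    let S : Set ℝ := {s | 0 ≤ s ∧ charFun ν s = 0}
    have hS : IsClosed S := isClosed_Ici.inter (isClosed_eq continuous_charFun continuous_const)
    have hb : BddBelow S := ⟨0, fun s hs => hs.1⟩
    have hmem : sInf S ∈ S := hS.csInf_mem ⟨t, ht, h0⟩ hb
    set s := sInf S with hs
    have hs0 : 0 < s := by
      refine lt_of_le_of_ne hmem.1 fun he => ?_
      have := hmem.2
      rw [← he, charFun_zero_eq_one] at this
      exact one_ne_zero this
    have hlt (r : ℝ) (hr : r ∈ Set.Ico 0 s) : charFun ν r ≠ 0 := fun h1 =>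
      not_lt_of_ge (csInf_le hb ⟨hr.1, h1⟩) hr.2
    have hne : charFun ν (2 * (s / 2)) ≠ 0 := by
      refine ne_zero_two_mul_of_forall_pow (hlt _ ⟨by positivity, by linarith⟩) fun n hn => ?_
      obtain ⟨μ, hμ, hμ2, hode⟩ := h n hn
      -- At the first zero `s` the equation can only be integrated on `[0, s)`; continuity carries
      -- `F = Gⁿ` to `s`, so the doubling argument applies to `s/2` and `s`.
      have hsub : Set.Ico 0 s ⊆ {r | charFun ν r = charFun μ r ^ n} := fun r hr =>
        charFun_eq_pow_of_forall_ne_zero hμ2 hν hn hode hr.1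
          fun q hq => hlt q ⟨hq.1, hq.2.trans_lt hr.2⟩
      have hcl := closure_minimal hsub
        (isClosed_eq continuous_charFun (continuous_charFun.pow n))
      rw [closure_Ico hs0.ne] at hcl
      exact ⟨μ, hμ, hcl ⟨by positivity, by linarith⟩, hcl ⟨by positivity, by linarith⟩⟩
    rw [mul_div_cancel₀ _ two_ne_zero] at hne
    exact hne hmem.2
  intro n hn
  obtain ⟨μ, hμ, hμ2, hode⟩ := h n hn
  have hnonneg (t : ℝ) (ht : 0 ≤ t) : charFun ν t = charFun μ t ^ n :=
    charFun_eq_pow_of_forall_ne_zero hμ2 hν hn hode ht fun s hs => hpos s hs.1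
  refine ⟨μ, hμ, fun t => ?_⟩
  rcases le_total 0 t with ht | ht
  · exact hnonneg t ht
  · have := hnonneg (-t) (by linarith)
    rw [charFun_neg, charFun_neg, ← map_pow] at this
    exact (starRingEnd ℂ).injective this

/-! ### Logarithm and real powers of an infinitely divisible characteristic function -/

theorem IsInfinitelyDivisible.charFun_ne_zero {ν : Measure ℝ} [IsProbabilityMeasure ν]
    (h : IsInfinitelyDivisible ν) (t : ℝ) : charFun ν t ≠ 0 := by
  have hstep (s : ℝ) (hs : charFun ν s ≠ 0) : charFun ν (2 * s) ≠ 0 :=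
    ne_zero_two_mul_of_forall_pow hs fun n hn => by
      obtain ⟨ρ, hρ, h1⟩ := h n hn
      exact ⟨ρ, hρ, h1 _, h1 _⟩
  have hiter (m : ℕ) : ∀ s, charFun ν s ≠ 0 → charFun ν (2 ^ m * s) ≠ 0 := by
    induction m with
    | zero => simp
    | succ m ih =>
      intro s hs
      rw [pow_succ, mul_assoc]
      exact ih _ (hstep s hs)
  -- Some `t / 2^m` is close enough to `0` for `F` not to vanish there; doubling `m` times returns
  -- to `t`.
  have hlim : Tendsto (fun m : ℕ => charFun ν ((1 / 2) ^ m * t)) atTop (𝓝 1) := by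
    have h1 : Tendsto (fun m : ℕ => (1 / 2 : ℝ) ^ m * t) atTop (𝓝 0) := by
      simpa using (tendsto_pow_atTop_nhds_zero_of_lt_one (r := (1 / 2 : ℝ)) (by norm_num)
        (by norm_num)).mul_const t
    have h2 := (continuous_charFun (μ := ν)).tendsto 0
    rw [charFun_zero_eq_one] at h2
    exact h2.comp h1
  obtain ⟨m, hm⟩ := (hlim.eventually_ne one_ne_zero).exists
  have := hiter m _ hm
  rwa [← mul_assoc, ← mul_pow, mul_one_div_cancel two_ne_zero, one_pow, one_mul] at this

/-- A nonvanishing characteristic function has a differentiable logarithm. -/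
theorem exists_log_charFun {ν : Measure ℝ} [IsProbabilityMeasure ν]
    (hν : MemLp (fun x : ℝ => x) 2 ν) (h : ∀ t, charFun ν t ≠ 0) :
    ∃ ψ : ℝ → ℂ, ψ 0 = 0 ∧ (∀ t, HasDerivAt ψ (I * charMoment ν t / charFun ν t) t) ∧
      ∀ t, charFun ν t = exp (ψ t) := by
  have hc : Continuous fun t => I * charMoment ν t / charFun ν t :=
    (continuous_const.mul (continuous_charMoment hν)).div continuous_charFun h
  let ψ : ℝ → ℂ := fun t => ∫ s in (0 : ℝ)..t, I * charMoment ν s / charFun ν s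
  have hψ (t : ℝ) : HasDerivAt ψ (I * charMoment ν t / charFun ν t) t :=
    intervalIntegral.integral_hasDerivAt_right (hc.intervalIntegrable _ _)
      (hc.stronglyMeasurableAtFilter _ _) hc.continuousAt
  have h0 : ψ 0 = 0 := intervalIntegral.integral_same
  refine ⟨ψ, h0, hψ, fun t => ?_⟩
  have hd (s : ℝ) : HasDerivAt (fun s => charFun ν s * exp (-ψ s)) 0 s := by
    convert! (hasDerivAt_charFun hν s).mul (hψ s).neg.cexp using 1
    have := h s
    simp only [Pi.neg_apply]
    field_simp
    ring
  have h1 := is_const_of_deriv_eq_zero (f := fun s => charFun ν s * exp (-ψ s))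
    (fun s => (hd s).differentiableAt) (fun s => (hd s).deriv) t 0
  simp only [h0, charFun_zero_eq_one, neg_zero, Complex.exp_zero, mul_one] at h1
  rw [exp_neg, mul_inv_eq_iff_eq_mul₀ (exp_ne_zero _), one_mul] at h1
  exact h1

/-- A continuous function whose `n`-th power is the exponential of `ψ` is the exponential
of `ψ / n`. -/
theorem eq_exp_div_of_pow_eq_exp {φ ψ : ℝ → ℂ} (hφ : Continuous φ) (hψ : Continuous ψ)
    (hφ0 : φ 0 = 1) (hψ0 : ψ 0 = 0) {n : ℕ} (hn : 1 ≤ n) (h : ∀ t, φ t ^ n = exp (ψ t)) (t : ℝ) :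
    φ t = exp (ψ t / n) := by
  have hn0 : (n : ℂ) ≠ 0 := by exact_mod_cast (by omega : n ≠ 0)
  let T : Set ℂ := {z | z ^ n = 1}
  have hT : T.Finite := by
    refine (Polynomial.nthRoots n (1 : ℂ)).toFinset.finite_toSet.subset fun z hz => ?_
    simpa [T, Polynomial.mem_nthRoots (by omega : 0 < n)] using hz
  have := hT.to_subtype
  have hq : Continuous fun t => φ t * exp (-(ψ t / n)) := by fun_prop
  -- A continuous function on the line with values in the finite set of `n`-th roots of unity is
  -- constant.
  have hmaps : Set.MapsTo (fun t => φ t * exp (-(ψ t / n))) Set.univ T := by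
    intro s _
    change (φ s * exp (-(ψ s / n))) ^ n = 1
    rw [mul_pow, h, ← exp_nat_mul, mul_neg, mul_div_cancel₀ _ hn0, ← exp_add, add_neg_cancel,
      Complex.exp_zero]
  have hc := isPreconnected_univ.constant_of_mapsTo hT.isDiscrete hq.continuousOn hmaps
    (Set.mem_univ t) (Set.mem_univ 0)
  simp only [hφ0, hψ0, zero_div, neg_zero, Complex.exp_zero, mul_one] at hc
  rw [exp_neg, mul_inv_eq_iff_eq_mul₀ (exp_ne_zero _), one_mul] at hc
  exact hc

/-- The positive real powers of an infinitely divisible characteristic function are characteristic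
functions. -/
theorem IsInfinitelyDivisible.exists_charFun_eq_exp_mul {ν : Measure ℝ}
    (h : IsInfinitelyDivisible ν) {ψ : ℝ → ℂ} (hψ : Continuous ψ) (hψ0 : ψ 0 = 0)
    (hexp : ∀ t, charFun ν t = exp (ψ t)) {γ : ℝ} (hγ : 0 < γ) :
    ∃ μ : Measure ℝ, IsProbabilityMeasure μ ∧ ∀ t, charFun μ t = exp (γ * ψ t) := by
  have hroot (n : ℕ) (m : ℕ) : ∃ ρ : Measure ℝ, IsProbabilityMeasure ρ ∧
      ∀ t, charFun ρ t = exp (m * (ψ t / (n + 1 : ℕ))) := by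
    obtain ⟨ρ, hρ, h1⟩ := h (n + 1) (by omega)
    obtain ⟨κ, hκ, h2⟩ := exists_charFun_eq_pow ρ m
    refine ⟨κ, hκ, fun t => ?_⟩
    rw [h2, eq_exp_div_of_pow_eq_exp continuous_charFun hψ (charFun_zero_eq_one ρ) hψ0
      (by omega : 1 ≤ n + 1) (fun s => by rw [← h1, hexp]) t, ← exp_nat_mul]
  -- The exponents `⌊γ(n+1)⌋ / (n+1)` are nonnegative rationals tending to `γ`.
  choose ρ hρ h1 using fun n : ℕ => hroot n ⌊γ * ((n + 1 : ℕ) : ℝ)⌋₊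
  refine exists_charFun_eq_of_tendsto (μ := ρ) (f := fun t => exp (γ * ψ t))
    (by fun_prop) fun t => ?_
  simp_rw [h1]
  have hlim : Tendsto (fun n : ℕ => (⌊γ * ((n + 1 : ℕ) : ℝ)⌋₊ : ℝ) / ((n + 1 : ℕ) : ℝ)) atTop
      (𝓝 γ) :=
    (tendsto_nat_floor_mul_div_atTop hγ.le).comp
      (tendsto_natCast_atTop_atTop.comp (tendsto_add_atTop_nat 1))
  have hlim' := ((continuous_ofReal.tendsto γ).comp hlim).mul_const (ψ t)
  refine ((continuous_exp.tendsto _).comp hlim').congr fun n => ?_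
  simp only [Function.comp_apply]
  congr 1
  push_cast
  ring

/-- Where `|F| > 1/2`, `norm_charMoment_le` bounds the derivative of `exp (γψ)` on `[0, t]` by
`2γσ²t`, with `σ²` the noise variance; the mean value inequality supplies the second factor `t`. -/
theorem one_sub_re_charFun_le_of_eq_exp_mul {μ ν : Measure ℝ} [IsProbabilityMeasure μ]
    [IsProbabilityMeasure ν] (hν : MemLp (fun x : ℝ => x) 2 ν) (hν0 : ∫ z, z ∂ν = 0) {ψ : ℝ → ℂ}
    (hψ : ∀ t, HasDerivAt ψ (I * charMoment ν t / charFun ν t) t) {γ : ℝ}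
    (hγ : 0 < γ) (h : ∀ t, charFun μ t = exp (γ * ψ t)) :
    ∃ δ, 0 < δ ∧ ∀ t, 0 < t → t < δ →
      1 - (charFun μ t).re ≤ (2 * γ * ∫ z, z ^ 2 ∂ν) * t ^ 2 := by
  have hnear : ∀ᶠ t in 𝓝 (0 : ℝ), 1 / 2 < ‖charFun ν t‖ := by
    have h1 := (continuous_charFun (μ := ν)).norm.tendsto 0
    rw [charFun_zero_eq_one, norm_one] at h1
    exact h1.eventually_const_lt (by norm_num)
  obtain ⟨δ, hδ, hb⟩ := Metric.eventually_nhds_iff.1 hnear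
  refine ⟨δ, hδ, fun t ht htδ => ?_⟩
  have hσ : 0 ≤ ∫ z, z ^ 2 ∂ν := integral_nonneg fun z => sq_nonneg z
  have hd (s : ℝ) : HasDerivAt (charFun μ)
      (charFun μ s * (γ * (I * charMoment ν s / charFun ν s))) s := by
    rw [funext h]
    exact ((hψ s).const_mul (γ : ℂ)).cexp
  have hbound (s : ℝ) (hs : s ∈ Set.Icc 0 t) :
      ‖charFun μ s * (γ * (I * charMoment ν s / charFun ν s))‖ ≤
        2 * γ * (∫ z, z ^ 2 ∂ν) * t := by
    have h2 : 1 / 2 < ‖charFun ν s‖ := hb (by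
      rw [Real.dist_eq, sub_zero, abs_of_nonneg hs.1]
      exact hs.2.trans_lt htδ)
    have h3 : ‖charMoment ν s‖ ≤ t * ∫ z, z ^ 2 ∂ν := by
      refine (norm_charMoment_le hν hν0 s).trans ?_
      rw [abs_of_nonneg hs.1]
      exact mul_le_mul_of_nonneg_right hs.2 hσ
    have h4 := norm_charFun_le_one (μ := μ) s
    rw [norm_mul, norm_mul, norm_div, norm_mul, norm_I, one_mul, norm_real, Real.norm_eq_abs,
      abs_of_pos hγ]
    calc ‖charFun μ s‖ * (γ * (‖charMoment ν s‖ / ‖charFun ν s‖))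
        ≤ 1 * (γ * ((t * ∫ z, z ^ 2 ∂ν) / (1 / 2))) := by gcongr
      _ = _ := by ring
  have hmv := (convex_Icc (0 : ℝ) t).norm_image_sub_le_of_norm_hasDerivWithin_le
    (fun s _ => (hd s).hasDerivWithinAt) hbound ⟨le_rfl, ht.le⟩ ⟨ht.le, le_rfl⟩
  rw [charFun_zero_eq_one, sub_zero, Real.norm_eq_abs, abs_of_pos ht] at hmv
  have hre : 1 - (charFun μ t).re ≤ ‖charFun μ t - 1‖ := by
    rw [norm_sub_rev]
    simpa using Complex.re_le_norm (1 - charFun μ t)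
  calc 1 - (charFun μ t).re ≤ _ := hre.trans hmv
    _ = _ := by ring

theorem IsInfinitelyDivisible.exists_isMatchingSource {ν : Measure ℝ}
    (h : IsInfinitelyDivisible ν) (hν : IsCentered ν) (hvar : 0 < ∫ z, z ^ 2 ∂ν) {γ : ℝ}
    (hγ : 0 < γ) : ∃ μ : Measure ℝ, IsMatchingSource γ μ ν := by
  have := hν.isProbabilityMeasure
  have hν2 := hν.memLp_two
  have hν0 := hν.mean_eq_zero
  obtain ⟨ψ, hψ0, hψ, hexp⟩ := exists_log_charFun hν2 h.charFun_ne_zero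
  have hψc : Continuous ψ := continuous_iff_continuousAt.2 fun t => (hψ t).continuousAt
  obtain ⟨μ, hμ, hμexp⟩ := h.exists_charFun_eq_exp_mul hψc hψ0 hexp hγ
  obtain ⟨δ, hδ, hle⟩ := one_sub_re_charFun_le_of_eq_exp_mul hν2 hν0 hψ hγ hμexp
  have hμ2 := memLp_two_of_one_sub_re_charFun_le hδ hle
  set k : ℝ := γ / (1 + γ) with hk
  have hk1 : (1 - k) * γ = k := by rw [hk]; field_simp; ring
  have hk0 : 1 - k ≠ 0 := by
    intro h0
    rw [h0, zero_mul] at hk1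
    rw [← hk1] at h0
    norm_num at h0
  have hode (t : ℝ) :
      (1 - k) * charMoment μ t * charFun ν t = k * charFun μ t * charMoment ν t := by
    have hd : HasDerivAt (charFun μ)
        (charFun μ t * (γ * (I * charMoment ν t / charFun ν t))) t := by
      rw [funext hμexp]
      exact ((hψ t).const_mul (γ : ℂ)).cexp
    have h1 := (hasDerivAt_charFun hμ2 t).unique hd
    have h2 : charMoment μ t * charFun ν t = γ * charFun μ t * charMoment ν t := by
      have h3 := h.charFun_ne_zero t
      refine mul_left_cancel₀ I_ne_zero ?_
      rw [← mul_assoc, h1]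
      field_simp
    have hk1' : (1 - (k : ℂ)) * γ = k := by exact_mod_cast congrArg ofReal hk1
    rw [mul_assoc, h2]
    linear_combination charFun μ t * charMoment ν t * hk1'
  have horth {g : ℝ → ℝ} (hg : Measurable g)
      (hg2 : MemLp (fun p : ℝ × ℝ => g (p.1 + p.2)) 2 (μ.prod ν)) :=
    integral_linear_error_mul_eq_zero hμ2 hν2 hode hg hg2
  -- The test functions `1` and `y` recover the mean and the signal to noise ratio of the
  -- constructed source.
  have hmean := horth (measurable_const (a := (1 : ℝ))) (memLp_const 1)
  have hsq := horth measurable_id (memLp_observation hμ2 hν2)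
  simp only [mul_one, id_eq] at hmean hsq
  rw [integral_linear_error hμ2 hν2 hν0] at hmean
  rw [integral_linear_error_mul_observation hμ2 hν2 hν0] at hsq
  refine ⟨μ, ⟨hμ, hμ2, (mul_eq_zero.1 hmean).resolve_left hk0⟩, ?_,
    k, isOptimalEstimator_of_integral_mul_eq_zero hμ2 hν2 horth⟩
  rw [snr, div_eq_iff hvar.ne']
  refine mul_left_cancel₀ hk0 ?_
  rw [← mul_assoc, hk1]
  linarith

end LinearEstimation

theorem corollary2 (ν : Measure ℝ) (hν : LinearEstimation.IsCentered ν)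
    (hvar : 0 < ∫ z, z ^ 2 ∂ν) :
    (∀ γ : ℝ, 0 < γ → ∃ μ : Measure ℝ, LinearEstimation.IsMatchingSource γ μ ν) ↔
      LinearEstimation.IsInfinitelyDivisible ν := by
  have := hν.isProbabilityMeasure
  refine ⟨fun h => ?_, fun h γ hγ => h.exists_isMatchingSource hν hvar hγ⟩
  refine LinearEstimation.isInfinitelyDivisible_of_forall_exists hν.memLp_two fun n hn => ?_
  have hn0 : (0 : ℝ) < n := by exact_mod_cast hn
  obtain ⟨μ, hμ⟩ := h (n : ℝ)⁻¹ (inv_pos.2 hn0)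
  refine ⟨μ, hμ.isCentered.isProbabilityMeasure, hμ.isCentered.memLp_two, fun t => ?_⟩
  have h1 := hμ.charMoment_mul_charFun hν hvar t
  have hn1 : (n : ℂ) ≠ 0 := by exact_mod_cast hn0.ne'
  rw [mul_assoc, h1]
  push_cast
  field_simp
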